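/- For $0<\alpha<1$ let $\mathbf Z_\alpha$ be the standard positive $\alpha$-stable random variable, i.e. the positive random variable with $\mathbb E[e^{-\lambda \mathbf Z_\alpha}]=e^{-\lambda^\alpha}$ for all $\lambda\ge 0$. Let $\mathbf L$ be the unit exponential random variable, let $\mathbf\Gamma_c$ ($c>0$) be the Gamma random variable with density $x^{c-1}e^{-x}/\Gamma(c)$ on $(0,\infty)$, and let $\mathbf B_{a,b}$ ($a,b>0$) be the Beta random variable with density $\frac{\Gamma(a+b)}{\Gamma(a)\Gamma(b)}x^{a-1}(1-x)^{b-1}$ on $(0,1)$; put $\mathbf B_{a,0}=1$. All products of random variables below are products of independent random variables, and empty products equal $1$. Let $n>p\ge 1$ be integers. Put $q_0=0$, $q_p=n$ and, for $1\le j\le p-1$, $q_j=\sup\{i\ge 1:\ ip<jn\}$. Then $$\mathbf Z_{p/n}^{-p}\ \stackrel{d}{=}\ \frac{n^n}{p^p}\ \prod_{j=0}^{p-1}\Bigl(\prod_{i=q_j+1}^{q_{j+1}-1}\mathbf\Gamma_{\frac in}\Bigr)\times\prod_{j=1}^{p-1}\mathbf B_{\frac{q_j}{n},\,\frac jp-\frac{q_j}{n}}$$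 and $$\mathbf Z_{p/n}^{-p}\ \stackrel{d}{=}\ \frac{n^n}{p^p(n-p)^{n-p}}\ \mathbf L^{n-p}\times\prod_{j=0}^{p-1}\Bigl(\prod_{i=q_j+1}^{q_{j+1}-1}\mathbf B_{\frac in,\,\frac{i-j}{n-p}-\frac in}\Bigr)\times\prod_{j=1}^{p-1}\mathbf B_{\frac{q_j}{n},\,\frac jp-\frac{q_j}{n}}.$$ -/

import Mathlib

open MeasureTheory ProbabilityTheory Finset

/-- `Z` is a standard positive `α`-stable random variable under `P`: it is positive and its Laplace
transform is `l ↦ exp (-l ^ α)` on `[0, ∞)`. -/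
structure IsPositiveStable {Ω : Type*} [MeasurableSpace Ω] (α : ℝ) (Z : Ω → ℝ) (P : Measure Ω) :
    Prop where
  aemeasurable : AEMeasurable Z P
  pos : ∀ᵐ ω ∂P, 0 < Z ω
  laplace : ∀ l : ℝ, 0 ≤ l → ∫ ω, Real.exp (-(l * Z ω)) ∂P = Real.exp (-(l ^ α))

/-- The indices `q_0 = 0`, `q_p = n` and `q_j = sup {i ≥ 1 : i p < j n}` for `1 ≤ j ≤ p - 1`. -/
noncomputable def qIndex (n p j : ℕ) : ℕ :=
  if j = 0 then 0 else if j = p then n else sSup {i : ℕ | 1 ≤ i ∧ i * p < j * n}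

/-- The set of integers `i` with `q_j + 1 ≤ i ≤ q_{j+1} - 1`. -/
noncomputable def qBlock (n p j : ℕ) : Finset ℕ :=
  Finset.Ioo (qIndex n p j) (qIndex n p (j + 1))

/-- The index set of a double product over `0 ≤ j ≤ p - 1` and `q_j + 1 ≤ i ≤ q_{j+1} - 1`. -/
abbrev BlockPairs (n p : ℕ) : Type :=
  {x : ℕ × ℕ // x.1 ∈ Finset.range p ∧ x.2 ∈ qBlock n p x.1}

/-- The law of `B_{a,b}` for `a > 0` and `b ≥ 0`: the Beta distribution if `b > 0`, and the unit
mass at `1` (its limit as `b → 0`) if `b = 0`. -/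
noncomputable def betaLaw (a b : ℝ) : Measure ℝ :=
  if b = 0 then Measure.dirac 1 else betaMeasure a b

/-! Both sides are almost surely positive, so it is enough to compare `E[X ^ s]` for all `s > 0`.
These moments are the moment generating function of `log X` on `(0, ∞)`, and they determine the law
by analytic continuation (`HasPowerMoments.identDistrib`).

Integrating the Laplace transform against `l ^ (t - 1)` gives `E[Z ^ (-t)] = Γ(1 + t/α) / Γ(1 + t)`,
so the left side has moments `Γ(1 + n s) / Γ(1 + p s)`. Gauss' multiplication formula turns this, up
to the factor `(n ^ n / p ^ p) ^ s`, into the product of `gammaRatio (i/n) s` over `0 < i < n`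
divided by that of `gammaRatio (j/p) s` over `0 < j < p`. The `q_j` with `0 < j < p` cut `{1, ...,
n-1}` into `p` blocks. Pairing `q_j` with `j` gives the Beta moment `gammaRatio (q_j/n) s /
gammaRatio (j/p) s`, and the indices inside the blocks give the Gamma moments. This is the first
identity.

For the second, `(j, i) ↦ i - j` maps the block indices bijectively onto `{1, ..., n-p}`. Hence the
denominators `gammaRatio ((i-j)/(n-p)) s` of the new Beta moments multiply, again by Gauss, to `Γ(1
+ (n-p) s)` up to a power. That Gamma value is the moment of `L ^ (n-p)`. -/

/-! ### Laws determined by the moment generating function on a half-line -/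

theorem mem_interior_integrableExpSet {Ω : Type*} [MeasurableSpace Ω] {P : Measure Ω} {X : Ω → ℝ}
    (hXi : ∀ t : ℝ, 0 < t → Integrable (fun ω => Real.exp (t * X ω)) P) {t : ℝ} (ht : 0 < t) :
    t ∈ interior (integrableExpSet X P) := by
  have hsub : Set.Ioi (0 : ℝ) ⊆ integrableExpSet X P := fun s hs => hXi s hs
  exact interior_mono hsub (by rwa [interior_Ioi])

/-- Analyticity is only available in the open right half-plane, whose boundary carries the
characteristic function. Dominated convergence reaches it: `exp (ε X) ≤ 1 + exp X` for `0 < ε < 1`.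
-/
theorem tendsto_complexMGF_imaginaryAxis {Ω : Type*} [MeasurableSpace Ω] {P : Measure Ω}
    [IsProbabilityMeasure P] {X : Ω → ℝ} (hX : AEMeasurable X P)
    (hXi : Integrable (fun ω => Real.exp (1 * X ω)) P) (t : ℝ) :
    Filter.Tendsto (fun ε : ℝ => complexMGF X P (ε + t * Complex.I))
      (nhdsWithin 0 (Set.Ioi 0)) (nhds (complexMGF X P (t * Complex.I))) := by
  have hlim := tendsto_integral_filter_of_dominated_convergence
    (μ := P) (l := nhdsWithin (0 : ℝ) (Set.Ioi 0))
    (F := fun (ε : ℝ) ω => Complex.exp ((ε + t * Complex.I) * X ω))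
    (f := fun ω => Complex.exp ((t * Complex.I) * X ω))
    (fun ω => 1 + Real.exp (1 * X ω)) ?_ ?_ ((integrable_const 1).add hXi) ?_
  · exact hlim
  · exact Filter.Eventually.of_forall fun ε =>
      (by fun_prop : AEMeasurable _ P).aestronglyMeasurable
  · have hmem : Set.Ioo (0 : ℝ) 1 ∈ nhdsWithin (0 : ℝ) (Set.Ioi 0) :=
      Ioo_mem_nhdsGT one_pos
    filter_upwards [hmem] with ε hε
    refine Filter.Eventually.of_forall fun ω => ?_
    rw [Complex.norm_exp]
    simp only [Complex.mul_re, Complex.add_re, Complex.ofReal_re, Complex.I_re, mul_zero,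
      Complex.ofReal_im, Complex.I_im, sub_zero, add_zero, zero_mul, one_mul]
    rcases le_total (X ω) 0 with h0 | h0
    · have : Real.exp (ε * X ω) ≤ 1 :=
        Real.exp_le_one_iff.2 (mul_nonpos_of_nonneg_of_nonpos hε.1.le h0)
      linarith [Real.exp_pos (X ω)]
    · have : Real.exp (ε * X ω) ≤ Real.exp (X ω) :=
        Real.exp_le_exp.2 (mul_le_of_le_one_left h0 hε.2.le)
      linarith
  · refine Filter.Eventually.of_forall fun ω => ?_
    have hc : Continuous fun ε : ℝ => Complex.exp ((ε + t * Complex.I) * X ω) := by fun_prop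
    have := hc.tendsto 0
    simp only [Complex.ofReal_zero, zero_add] at this
    exact this.mono_left nhdsWithin_le_nhds

/-- The moment generating function on `(0, ∞)` determines the law of a real random variable. -/
theorem map_eq_of_mgf_eq_of_pos {Ω Ω' : Type*} [MeasurableSpace Ω] [MeasurableSpace Ω']
    {P : Measure Ω} {Q : Measure Ω'} [IsProbabilityMeasure P] [IsProbabilityMeasure Q]
    {X : Ω → ℝ} {Y : Ω' → ℝ} (hX : AEMeasurable X P) (hY : AEMeasurable Y Q)
    (hXi : ∀ t : ℝ, 0 < t → Integrable (fun ω => Real.exp (t * X ω)) P)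
    (hYi : ∀ t : ℝ, 0 < t → Integrable (fun ω => Real.exp (t * Y ω)) Q)
    (h : ∀ t : ℝ, 0 < t → mgf X P t = mgf Y Q t) : P.map X = Q.map Y := by
  have hXan : AnalyticOnNhd ℂ (complexMGF X P) {z | 0 < z.re} := fun z hz =>
    analyticAt_complexMGF (mem_interior_integrableExpSet hXi hz)
  have hYan : AnalyticOnNhd ℂ (complexMGF Y Q) {z | 0 < z.re} := fun z hz =>
    analyticAt_complexMGF (mem_interior_integrableExpSet hYi hz)
  have hpre : IsPreconnected {z : ℂ | 0 < z.re} :=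
    (convex_halfSpace_re_gt 0).isPreconnected
  -- The identity theorem needs agreement only along points accumulating at an interior point: the
  -- reals `1 + 1/(k+1)` tend to `1`.
  have hfreq : ∃ᶠ z in nhdsWithin (1 : ℂ) {1}ᶜ, complexMGF X P z = complexMGF Y Q z := by
    have hlim : Filter.Tendsto (fun k : ℕ => (((1 + 1 / ((k : ℝ) + 1) : ℝ)) : ℂ)) Filter.atTop
        (nhdsWithin (1 : ℂ) {1}ᶜ) := by
      rw [tendsto_nhdsWithin_iff]
      refine ⟨?_, Filter.Eventually.of_forall fun k => ?_⟩
      · have h1 := (tendsto_one_div_add_atTop_nhds_zero_nat (𝕜 := ℝ)).const_add 1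
        rw [add_zero] at h1
        exact_mod_cast (Complex.continuous_ofReal.tendsto 1).comp h1
      · have : (1 : ℝ) / ((k : ℝ) + 1) ≠ 0 := by positivity
        simp only [Set.mem_compl_iff, Set.mem_singleton_iff]
        intro h0
        have h1 : (1 + 1 / ((k : ℝ) + 1) : ℝ) = 1 := by exact_mod_cast h0
        exact this (by linarith)
    refine hlim.frequently (Filter.Frequently.of_forall fun k => ?_)
    rw [complexMGF_ofReal, complexMGF_ofReal, h _ (by positivity)]
  have hEq := hXan.eqOn_of_preconnected_of_frequently_eq hYan hpre (z₀ := 1) (by simp) hfreq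
  have : IsProbabilityMeasure (P.map X) := Measure.isProbabilityMeasure_map hX
  have : IsProbabilityMeasure (Q.map Y) := Measure.isProbabilityMeasure_map hY
  refine Measure.ext_of_charFun (funext fun t => ?_)
  rw [← complexMGF_mul_I hX, ← complexMGF_mul_I hY]
  refine tendsto_nhds_unique (tendsto_complexMGF_imaginaryAxis hX (hXi 1 one_pos) t)
    ((tendsto_complexMGF_imaginaryAxis hY (hYi 1 one_pos) t).congr' ?_)
  filter_upwards [self_mem_nhdsWithin] with ε hε
  exact (hEq (by simpa using hε)).symm

/-! ### Calculus of power moments -/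

/-- `X` is almost surely positive and `E[X ^ s] = M s` for every `s > 0`. -/
structure HasPowerMoments {Ω : Type*} [MeasurableSpace Ω] (X : Ω → ℝ) (P : Measure Ω)
    (M : ℝ → ℝ) : Prop where
  aemeasurable : AEMeasurable X P
  pos : ∀ᵐ ω ∂P, 0 < X ω
  integral_rpow : ∀ s : ℝ, 0 < s → ∫ ω, X ω ^ s ∂P = M s

namespace HasPowerMoments

variable {Ω Ω' : Type*} [MeasurableSpace Ω] [MeasurableSpace Ω'] {P : Measure Ω} {Q : Measure Ω'}
  {X : Ω → ℝ} {Y : Ω' → ℝ} {M : ℝ → ℝ}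

theorem rpow_ae_eq_exp (h : HasPowerMoments X P M) (s : ℝ) :
    (fun ω => X ω ^ s) =ᵐ[P] fun ω => Real.exp (s * Real.log (X ω)) := by
  filter_upwards [h.pos] with ω hω
  rw [Real.rpow_def_of_pos hω, mul_comm]

theorem integrable_exp (h : HasPowerMoments X P M) {s : ℝ} (hs : 0 < s) (hM : M s ≠ 0) :
    Integrable (fun ω => Real.exp (s * Real.log (X ω))) P := by
  -- The Bochner integral of a non-integrable function is `0`, so a nonzero moment already forces
  -- integrability.
  refine Integrable.of_integral_ne_zero ?_
  rwa [← integral_congr_ae (h.rpow_ae_eq_exp s), h.integral_rpow s hs]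

/-- Almost surely positive variables with the same finite power moments have the same law. -/
theorem identDistrib [IsProbabilityMeasure P] [IsProbabilityMeasure Q]
    (hX : HasPowerMoments X P M) (hY : HasPowerMoments Y Q M) (hM : ∀ s, 0 < s → M s ≠ 0) :
    IdentDistrib X Y P Q := by
  have hlog : IdentDistrib (fun ω => Real.log (X ω)) (fun ω => Real.log (Y ω)) P Q := by
    refine ⟨hX.aemeasurable.log, hY.aemeasurable.log,
      map_eq_of_mgf_eq_of_pos hX.aemeasurable.log hY.aemeasurable.log
      (fun t ht => hX.integrable_exp ht (hM t ht)) (fun t ht => hY.integrable_exp ht (hM t ht))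
      fun t ht => ?_⟩
    rw [mgf, mgf, ← integral_congr_ae (hX.rpow_ae_eq_exp t),
      ← integral_congr_ae (hY.rpow_ae_eq_exp t), hX.integral_rpow t ht, hY.integral_rpow t ht]
  have hexp := hlog.comp Real.measurable_exp
  refine (IdentDistrib.of_ae_eq hX.aemeasurable ?_).trans
    (hexp.trans (IdentDistrib.of_ae_eq hY.aemeasurable ?_).symm)
  · filter_upwards [hX.pos] with ω hω using (Real.exp_log hω).symm
  · filter_upwards [hY.pos] with ω hω using (Real.exp_log hω).symm

theorem const_mul (h : HasPowerMoments X P M) {c : ℝ} (hc : 0 < c) :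
    HasPowerMoments (fun ω => c * X ω) P (fun s => c ^ s * M s) where
  aemeasurable := h.aemeasurable.const_mul c
  pos := by filter_upwards [h.pos] with ω hω using mul_pos hc hω
  integral_rpow s hs := by
    rw [← h.integral_rpow s hs, ← integral_const_mul]
    refine integral_congr_ae ?_
    filter_upwards [h.pos] with ω hω using Real.mul_rpow hc.le hω.le

theorem pow (h : HasPowerMoments X P M) {k : ℕ} (hk : 0 < k) :
    HasPowerMoments (fun ω => X ω ^ k) P (fun s => M (k * s)) where
  aemeasurable := h.aemeasurable.pow_const k
  pos := by filter_upwards [h.pos] with ω hω using pow_pos hω k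
  integral_rpow s hs := by
    rw [← h.integral_rpow (k * s) (by positivity)]
    refine integral_congr_ae ?_
    filter_upwards [h.pos] with ω hω
    rw [Real.rpow_mul hω.le, Real.rpow_natCast]

theorem prod {ι : Type*} [Fintype ι] {X : ι → Ω → ℝ} {M : ι → ℝ → ℝ}
    (h : ∀ i, HasPowerMoments (X i) P (M i)) (hind : iIndepFun X P) :
    HasPowerMoments (fun ω => ∏ i, X i ω) P (fun s => ∏ i, M i s) where
  aemeasurable := Finset.aemeasurable_fun_prod _ fun i _ => (h i).aemeasurable
  pos := by
    filter_upwards [ae_all_iff.2 fun i => (h i).pos] with ω hω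
    exact Finset.prod_pos fun i _ => hω i
  integral_rpow s hs := by
    have hcomp : iIndepFun (fun i ω => X i ω ^ s) P :=
      hind.comp (fun _ x => x ^ s) fun _ => by fun_prop
    have hmeas (i : ι) : AEStronglyMeasurable (fun ω => X i ω ^ s) P :=
      ((h i).aemeasurable.pow_const s).aestronglyMeasurable
    rw [← Finset.prod_congr rfl fun i _ => (h i).integral_rpow s hs,
      ← hcomp.integral_fun_prod_eq_prod_integral hmeas]
    refine integral_congr_ae ?_
    filter_upwards [ae_all_iff.2 fun i => (h i).pos] with ω hω
    exact (Real.finsetProd_rpow _ _ (fun i _ => (hω i).le) s).symm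

theorem of_hasLaw {μ : Measure ℝ} (h : HasPowerMoments id μ M) (hX : HasLaw X μ P) :
    HasPowerMoments X P M where
  aemeasurable := hX.aemeasurable
  pos := by
    have := h.pos
    rw [← hX.map_eq] at this
    exact ae_of_ae_map hX.aemeasurable this
  integral_rpow s hs := by
    rw [← h.integral_rpow s hs, ← hX.map_eq, integral_map hX.aemeasurable]
    · rfl
    · exact (by fun_prop : Measurable fun x : ℝ => id x ^ s).aestronglyMeasurable

theorem congr_moments (h : HasPowerMoments X P M) {N : ℝ → ℝ} (hN : ∀ s, 0 < s → M s = N s) :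
    HasPowerMoments X P N :=
  ⟨h.aemeasurable, h.pos, fun s hs => (h.integral_rpow s hs).trans (hN s hs)⟩

end HasPowerMoments

/-! ### Gamma ratios and Gauss' multiplication formula -/

/-- The ratio `Γ(a + s) / Γ(a)`. -/
noncomputable def gammaRatio (a s : ℝ) : ℝ := Real.Gamma (a + s) / Real.Gamma a

theorem gammaRatio_pos {a s : ℝ} (ha : 0 < a) (hs : 0 ≤ s) : 0 < gammaRatio a s :=
  div_pos (Real.Gamma_pos_of_pos (by positivity)) (Real.Gamma_pos_of_pos ha)

theorem gammaRatio_one (s : ℝ) : gammaRatio 1 s = Real.Gamma (1 + s) := by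
  simp [gammaRatio]

theorem convexOn_finset_sum {ι : Type*} (t : Finset ι) {S : Set ℝ} (hS : Convex ℝ S)
    {f : ι → ℝ → ℝ} (hf : ∀ i ∈ t, ConvexOn ℝ S (f i)) :
    ConvexOn ℝ S (fun x => ∑ i ∈ t, f i x) := by
  classical
  induction t using Finset.induction_on with
  | empty => simpa using convexOn_const 0 hS
  | insert a t ha ih =>
    simp only [Finset.sum_insert ha]
    exact (hf a (by simp)).add (ih fun i hi => hf i (by simp [hi]))

/-- **Gauss' multiplication formula** for the Gamma function, on the positive half-line. -/
theorem Gamma_eq_rpow_mul_prod_Gamma (m : ℕ) (hm : 0 < m) {x : ℝ} (hx : 0 < x) :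
    Real.Gamma x = (m : ℝ) ^ (x - 1) *
      ∏ i ∈ range m, Real.Gamma ((x + i) / m) / Real.Gamma (((i : ℝ) + 1) / m) := by
  have hm' : (0 : ℝ) < m := by exact_mod_cast hm
  have hG (y : ℝ) (hy : 0 < y) (i : ℕ) :
      0 < Real.Gamma ((y + i) / m) / Real.Gamma (((i : ℝ) + 1) / m) :=
    div_pos (Real.Gamma_pos_of_pos (by positivity)) (Real.Gamma_pos_of_pos (by positivity))
  have hpos (y : ℝ) (hy : 0 < y) : 0 < (m : ℝ) ^ (y - 1) *
      ∏ i ∈ range m, Real.Gamma ((y + i) / m) / Real.Gamma (((i : ℝ) + 1) / m) :=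
    mul_pos (by positivity) (Finset.prod_pos fun i _ => hG y hy i)
  symm
  -- Bohr–Mollerup characterises `Γ`. The denominators `Γ((i+1)/m)` are chosen so that the value at
  -- `1` is `1`, which avoids computing the classical constant.
  refine Real.eq_Gamma_of_log_convex (f := fun x : ℝ => (m : ℝ) ^ (x - 1) *
      ∏ i ∈ range m, Real.Gamma ((x + i) / m) / Real.Gamma (((i : ℝ) + 1) / m))
      ?_ ?_ (fun {y} hy => hpos y hy) ?_ hx
  · have hlog : ConvexOn ℝ (Set.Ioi 0) (fun x : ℝ => (x - 1) * Real.log m +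
        ∑ i ∈ range m, (Real.log (Real.Gamma ((x + i) / m)) -
          Real.log (Real.Gamma (((i : ℝ) + 1) / m)))) := by
      refine ConvexOn.add ?_ (convexOn_finset_sum _ (convex_Ioi 0) fun i _ => ?_)
      · refine ⟨convex_Ioi 0, fun u _ v _ a b _ _ hab => le_of_eq ?_⟩
        simp only [smul_eq_mul]
        linear_combination Real.log m * hab
      · refine ConvexOn.sub ?_ (concaveOn_const _ (convex_Ioi 0))
        refine ⟨convex_Ioi 0, fun u hu v hv a b ha hb hab => ?_⟩
        have hu' : 0 < u := hu
        have hv' : 0 < v := hv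
        have := Real.convexOn_log_Gamma.2 (x := (u + i) / m) (y := (v + i) / m)
          (Set.mem_Ioi.2 (by positivity)) (Set.mem_Ioi.2 (by positivity)) ha hb hab
        simp only [smul_eq_mul, Function.comp_apply] at this ⊢
        refine le_trans (le_of_eq ?_) this
        congr 2
        field_simp
        linear_combination (-(i : ℝ)) * hab
    refine hlog.congr fun y hy => ?_
    simp only [Function.comp_apply]
    have hy' : 0 < y := hy
    rw [Real.log_mul (by positivity) (Finset.prod_pos fun i _ => hG y hy i).ne',
      Real.log_rpow hm', Real.log_prod fun i _ => (hG y hy i).ne']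
    congr 1
    refine Finset.sum_congr rfl fun i _ => ?_
    rw [Real.log_div (Real.Gamma_pos_of_pos (by positivity)).ne'
      (Real.Gamma_pos_of_pos (by positivity)).ne']
  · intro y hy
    -- Passing from `y` to `y + 1` shifts the index by one: `Γ(y/m)` leaves the product and `Γ(y/m +
    -- 1) = (y/m) Γ(y/m)` enters.
    have hshift : ∏ i ∈ range m, Real.Gamma ((y + 1 + i) / m) =
        y / m * ∏ i ∈ range m, Real.Gamma ((y + i) / m) := by
      have h1 := Finset.prod_range_succ' (fun i : ℕ => Real.Gamma ((y + i) / m)) m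
      rw [Finset.prod_range_succ] at h1
      have h2 : Real.Gamma ((y + m) / m) = y / m * Real.Gamma (y / m) := by
        rw [add_div, div_self hm'.ne', Real.Gamma_add_one (by positivity)]
      have h3 : Real.Gamma (y / m) ≠ 0 := (Real.Gamma_pos_of_pos (by positivity)).ne'
      have h4 : ∏ i ∈ range m, Real.Gamma ((y + 1 + i) / m) =
          ∏ i ∈ range m, Real.Gamma ((y + ((i + 1 : ℕ) : ℝ)) / m) :=
        Finset.prod_congr rfl fun i _ => by push_cast; ring_nf
      rw [h2, ← h4, Nat.cast_zero, add_zero] at h1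
      apply mul_right_cancel₀ h3
      rw [← h1]; ring
    simp only [Finset.prod_div_distrib]
    rw [hshift, show y + 1 - 1 = (y - 1) + 1 by ring, Real.rpow_add_one hm'.ne']
    field_simp
  · simp only [sub_self, Real.rpow_zero, one_mul]
    refine Finset.prod_eq_one fun i _ => ?_
    rw [add_comm (1 : ℝ)]
    exact div_self (Real.Gamma_pos_of_pos (by positivity)).ne'

theorem prod_Ioc_gammaRatio (m : ℕ) (hm : 0 < m) {s : ℝ} (hs : 0 < s) :
    Real.Gamma (1 + m * s) = ((m : ℝ) ^ m) ^ s * ∏ i ∈ Ioc 0 m, gammaRatio ((i : ℝ) / m) s := by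
  have hm' : (0 : ℝ) < m := by exact_mod_cast hm
  rw [Gamma_eq_rpow_mul_prod_Gamma m hm (by positivity : 0 < 1 + m * s), add_sub_cancel_left,
    Real.rpow_mul hm'.le, Real.rpow_natCast]
  congr 1
  have : Ioc 0 m = Ico (0 + 1) (m + 1) := by ext; simp; omega
  rw [this, ← Finset.prod_Ico_add' (fun i : ℕ => gammaRatio ((i : ℝ) / m) s) 0 m 1,
    ← Finset.range_eq_Ico]
  refine Finset.prod_congr rfl fun i _ => ?_
  rw [gammaRatio]
  push_cast
  congr 2
  field_simp
  ring

/-- The factor `i = m` is `Γ(1 + s)` whatever `m` is; once isolated, it cancels between `m = n` and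
`m = p`. -/
theorem prod_Ioo_gammaRatio (m : ℕ) (hm : 0 < m) {s : ℝ} (hs : 0 < s) :
    Real.Gamma (1 + m * s) = ((m : ℝ) ^ m) ^ s *
      ((∏ i ∈ Ioo 0 m, gammaRatio ((i : ℝ) / m) s) * Real.Gamma (1 + s)) := by
  rw [prod_Ioc_gammaRatio m hm hs, ← gammaRatio_one, ← Ioo_insert_right hm,
    Finset.prod_insert (by simp), div_self (by positivity), mul_comm (gammaRatio 1 s)]

/-! ### Combinatorics of the blocks -/

theorem prod_Ioo_eq_prod_blocks {q : ℕ → ℕ} {m : ℕ} (hm : 1 ≤ m)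
    (hq : ∀ j < m, q j < q (j + 1)) (f : ℕ → ℝ) :
    ∏ i ∈ Ioo (q 0) (q m), f i =
      (∏ j ∈ range m, ∏ i ∈ Ioo (q j) (q (j + 1)), f i) * ∏ j ∈ Ico 1 m, f (q j) := by
  induction m, hm using Nat.le_induction with
  | base => simp
  | succ m hm ih =>
    have h0 : q 0 < q m := by
      clear ih
      induction m, hm using Nat.le_induction with
      | base => exact hq 0 (by omega)
      | succ k hk ih => exact (ih fun j hj => hq j (by omega)).trans (hq k (by omega))
    have h1 := hq m (by omega)
    have hsplit : Ioo (q 0) (q (m + 1)) = (Ioo (q 0) (q m) ∪ {q m}) ∪ Ioo (q m) (q (m + 1)) := by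
      ext i; simp only [mem_union, mem_Ioo, mem_singleton]; omega
    rw [hsplit, prod_union, prod_union, prod_singleton, ih fun j hj => hq j (by omega),
      prod_range_succ, prod_Ico_succ_top hm]
    · ring
    · simp
    · rw [disjoint_left]; intro i; simp only [mem_union, mem_Ioo, mem_singleton]; omega

/-- Subtracting `j` on block `j` closes the gaps left by the separators: the block becomes `Ioc (q j
- j) (q (j+1) - (j+1))`, and these intervals are consecutive. The bound `m ≤ q m` is carried through
the induction so that the natural subtractions are not truncated. -/
theorem prod_blocks_sub {q : ℕ → ℕ} {m : ℕ} (h0 : q 0 = 0)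
    (hq : ∀ j < m, q j < q (j + 1)) (g : ℕ → ℝ) :
    m ≤ q m ∧ ∏ j ∈ range m, ∏ i ∈ Ioo (q j) (q (j + 1)), g (i - j) =
      ∏ k ∈ Ioc 0 (q m - m), g k := by
  induction m with
  | zero => simp [h0]
  | succ m ih =>
    obtain ⟨hle, ih⟩ := ih fun j hj => hq j (by omega)
    have h1 := hq m (by omega)
    refine ⟨by omega, ?_⟩
    have hblock : ∏ i ∈ Ioo (q m) (q (m + 1)), g (i - m) =
        ∏ k ∈ Ioc (q m - m) (q (m + 1) - (m + 1)), g k := by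
      refine prod_bij (fun i _ => i - m) ?_ ?_ ?_ fun _ _ => rfl
      · intro i hi; simp only [mem_Ioo, mem_Ioc] at *; omega
      · intro _ hi _ hk h; simp only [mem_Ioo] at *; omega
      · intro k hk
        simp only [mem_Ioc] at hk
        exact ⟨k + m, by simp only [mem_Ioo]; omega, by omega⟩
    rw [prod_range_succ, ih, hblock]
    have : Ioc 0 (q (m + 1) - (m + 1)) =
        Ioc 0 (q m - m) ∪ Ioc (q m - m) (q (m + 1) - (m + 1)) :=
      (Ioc_union_Ioc_eq_Ioc (by omega) (by omega)).symm
    rw [this, prod_union]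
    rw [disjoint_left]; intro i; simp only [mem_Ioc]; omega

theorem qIndex_zero (n p : ℕ) : qIndex n p 0 = 0 := by simp [qIndex]

theorem qIndex_self {n p : ℕ} (hp : 1 ≤ p) : qIndex n p p = n := by
  simp [qIndex, Nat.one_le_iff_ne_zero.1 hp]

/-- The supremum is attained because the set is bounded and contains `1`, as `p < n`. The strict
inequality makes the second Beta parameter `j/p - q_j/n` positive. -/
theorem qIndex_isGreatest {n p j : ℕ} (hpn : p < n) (hj : j ∈ Ico 1 p) :
    IsGreatest {i : ℕ | 1 ≤ i ∧ i * p < j * n} (qIndex n p j) := by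
  obtain ⟨h1, h2⟩ := mem_Ico.1 hj
  rw [qIndex, if_neg (by omega), if_neg (by omega)]
  have hne : {i : ℕ | 1 ≤ i ∧ i * p < j * n}.Nonempty := ⟨1, le_rfl, by nlinarith⟩
  have hbdd : BddAbove {i : ℕ | 1 ≤ i ∧ i * p < j * n} :=
    ⟨j * n, fun _ hi => by have := hi.2; nlinarith [hi.1]⟩
  exact ⟨Nat.sSup_mem hne hbdd, fun i hi => le_csSup hbdd hi⟩

theorem qIndex_lt_succ {n p j : ℕ} (hpn : p < n) (hj : j < p) :
    qIndex n p j < qIndex n p (j + 1) := by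
  have hlow : j ≠ 0 → qIndex n p j * p < j * n := fun h =>
    (qIndex_isGreatest hpn (mem_Ico.2 ⟨by omega, hj⟩)).1.2
  rcases Nat.lt_or_ge (j + 1) p with h | h
  · have hg := qIndex_isGreatest (j := j + 1) hpn (mem_Ico.2 ⟨by omega, h⟩)
    rcases Nat.eq_zero_or_pos j with rfl | h0
    · rw [qIndex_zero]; exact hg.1.1
    · refine hg.2 ⟨by omega, ?_⟩
      have := hlow (by omega)
      nlinarith
  · have : j + 1 = p := by omega
    rw [this, qIndex_self (by omega)]
    rcases Nat.eq_zero_or_pos j with rfl | h0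
    · rw [qIndex_zero]; omega
    · have := hlow (by omega)
      by_contra hcon
      nlinarith [not_lt.1 hcon]

theorem le_qIndex {n p : ℕ} (hpn : p < n) {j : ℕ} (hj : j ≤ p) : j ≤ qIndex n p j :=
  (prod_blocks_sub (qIndex_zero n p)
    (fun _ hi => qIndex_lt_succ hpn (hi.trans_le hj)) fun _ => 1).1

/-- An index beyond `q_j` fails `i p < j n` by maximality. The resulting `j n ≤ i p` is equivalent
to `(i-j)/(n-p) - i/n ≥ 0`; equality can occur, hence the degenerate case of `betaLaw`. -/
theorem mem_qBlock_bounds {n p i j : ℕ} (hpn : p < n) (hj : j ∈ range p)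
    (hi : i ∈ qBlock n p j) : 1 ≤ i ∧ j < i ∧ j * n ≤ i * p := by
  obtain ⟨h1, h2⟩ := mem_Ioo.1 hi
  have hj' := mem_range.1 hj
  have hle := le_qIndex hpn hj'.le
  refine ⟨by omega, by omega, ?_⟩
  rcases Nat.eq_zero_or_pos j with rfl | h0
  · simp
  · by_contra hcon
    have := (qIndex_isGreatest hpn (mem_Ico.2 ⟨h0, hj'⟩)).2 ⟨by omega, not_le.1 hcon⟩
    omega

theorem prod_Ioo_eq_prod_qBlock {n p : ℕ} (hp : 1 ≤ p) (hpn : p < n) (f : ℕ → ℝ) :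
    ∏ i ∈ Ioo 0 n, f i = (∏ j ∈ range p, ∏ i ∈ qBlock n p j, f i) *
      ∏ j ∈ Ico 1 p, f (qIndex n p j) := by
  have := prod_Ioo_eq_prod_blocks (q := qIndex n p) hp (fun j hj => qIndex_lt_succ hpn hj) f
  rwa [qIndex_zero, qIndex_self hp] at this

theorem prod_qBlock_sub {n p : ℕ} (hp : 1 ≤ p) (hpn : p < n) (g : ℕ → ℝ) :
    ∏ j ∈ range p, ∏ i ∈ qBlock n p j, g (i - j) = ∏ k ∈ Ioc 0 (n - p), g k := by
  have := (prod_blocks_sub (qIndex_zero n p) (fun j hj => qIndex_lt_succ hpn hj) g).2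
  rwa [qIndex_self hp] at this

/-! ### Moments of the Beta, Gamma and exponential laws -/

theorem integral_Ioi_rpow_mul_exp_neg {a : ℝ} (ha : 0 < a) :
    ∫ x in Set.Ioi (0 : ℝ), x ^ (a - 1) * Real.exp (-x) = Real.Gamma a := by
  have := Real.integral_rpow_mul_exp_neg_mul_Ioi ha one_pos
  simpa using this

theorem integral_Ioo_rpow_mul_one_sub_rpow {a b : ℝ} (ha : 0 < a) (hb : 0 < b) :
    ∫ x in Set.Ioo (0 : ℝ) 1, x ^ (a - 1) * (1 - x) ^ (b - 1) = beta a b := by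
  have h1 := lintegral_betaPDF_eq_one ha hb
  have hbeta := beta_pos ha hb
  have h2 : ∫ x in Set.Ioo (0 : ℝ) 1, 1 / beta a b * x ^ (a - 1) * (1 - x) ^ (b - 1) = 1 := by
    rw [integral_eq_lintegral_of_nonneg_ae, ← lintegral_betaPDF, h1, ENNReal.toReal_one]
    · refine ae_restrict_of_forall_mem measurableSet_Ioo fun x hx => ?_
      have := hx.1
      have : 0 < 1 - x := sub_pos.2 hx.2
      simp only [Pi.zero_apply]
      positivity
    · exact (by fun_prop : Measurable _).aestronglyMeasurable
  simp_rw [mul_assoc] at h2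
  rw [integral_const_mul] at h2
  field_simp at h2
  exact h2

theorem integral_betaMeasure {a b : ℝ} (ha : 0 < a) (hb : 0 < b) (f : ℝ → ℝ) :
    ∫ x, f x ∂(betaMeasure a b) = (beta a b)⁻¹ *
      ∫ x in Set.Ioo (0 : ℝ) 1, f x * (x ^ (a - 1) * (1 - x) ^ (b - 1)) := by
  have hbeta := beta_pos ha hb
  have hnn (x : ℝ) : 0 ≤ betaPDFReal a b x := by
    by_cases h : 0 < x ∧ x < 1
    · exact (betaPDFReal_pos h.1 h.2 ha hb).le
    · rw [betaPDFReal, if_neg h]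
  have hmeas : Measurable (betaPDF a b) := (measurable_betaPDFReal a b).ennreal_ofReal
  rw [betaMeasure, integral_withDensity_eq_integral_toReal_smul hmeas
    (ae_of_all _ fun x => ENNReal.ofReal_lt_top), ← integral_const_mul,
    ← integral_indicator measurableSet_Ioo]
  refine integral_congr_ae (ae_of_all _ fun x => ?_)
  simp only [betaPDF, ENNReal.toReal_ofReal (hnn x), smul_eq_mul]
  by_cases h : 0 < x ∧ x < 1
  · rw [Set.indicator_of_mem (show x ∈ Set.Ioo (0 : ℝ) 1 from h), betaPDFReal, if_pos h]
    ring
  · rw [Set.indicator_of_notMem (show x ∉ Set.Ioo (0 : ℝ) 1 from h), betaPDFReal, if_neg h,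
      zero_mul]

theorem hasPowerMoments_betaMeasure {a b : ℝ} (ha : 0 < a) (hb : 0 < b) :
    HasPowerMoments id (betaMeasure a b) (fun s => gammaRatio a s / gammaRatio (a + b) s) where
  aemeasurable := aemeasurable_id
  pos := by
    have hmeas : Measurable (betaPDF a b) := (measurable_betaPDFReal a b).ennreal_ofReal
    rw [betaMeasure, ae_withDensity_iff hmeas]
    refine ae_of_all _ fun x hx => ?_
    by_contra hcon
    exact hx (betaPDF_eq_zero_of_nonpos (not_lt.1 hcon))
  integral_rpow s hs := by
    rw [integral_betaMeasure ha hb]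
    have : ∫ x in Set.Ioo (0 : ℝ) 1, id x ^ s * (x ^ (a - 1) * (1 - x) ^ (b - 1)) =
        ∫ x in Set.Ioo (0 : ℝ) 1, x ^ (a + s - 1) * (1 - x) ^ (b - 1) := by
      refine setIntegral_congr_fun measurableSet_Ioo fun x hx => ?_
      simp only [id]
      rw [← mul_assoc, ← Real.rpow_add hx.1]
      ring_nf
    rw [this, integral_Ioo_rpow_mul_one_sub_rpow (by positivity) hb, beta, beta, gammaRatio,
      gammaRatio, show a + s + b = a + b + s by ring]
    have h1 := (Real.Gamma_pos_of_pos ha).ne'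
    have h2 := (Real.Gamma_pos_of_pos hb).ne'
    have h3 := (Real.Gamma_pos_of_pos (by positivity : 0 < a + b)).ne'
    have h4 := (Real.Gamma_pos_of_pos (by positivity : 0 < a + b + s)).ne'
    field_simp

theorem hasPowerMoments_betaLaw {a b : ℝ} (ha : 0 < a) (hb : 0 ≤ b) :
    HasPowerMoments id (betaLaw a b) (fun s => gammaRatio a s / gammaRatio (a + b) s) := by
  rcases hb.eq_or_lt with rfl | hb
  · rw [betaLaw, if_pos rfl]
    refine ⟨aemeasurable_id, by simp [ae_dirac_eq], fun s hs => ?_⟩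
    rw [add_zero, div_self (gammaRatio_pos ha hs.le).ne', integral_dirac]
    simp
  · rw [betaLaw, if_neg hb.ne']
    exact hasPowerMoments_betaMeasure ha hb

theorem hasPowerMoments_gammaMeasure {a : ℝ} (ha : 0 < a) :
    HasPowerMoments id (gammaMeasure a 1) (gammaRatio a) where
  aemeasurable := aemeasurable_id
  pos := by
    have hmeas : Measurable (gammaPDF a 1) := (measurable_gammaPDFReal a 1).ennreal_ofReal
    rw [gammaMeasure, ae_withDensity_iff hmeas]
    -- The density need not vanish at `0` (for `a = 1` it is `1` there), so this null point is
    -- discarded.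
    have h0 : ∀ᵐ x : ℝ, x ≠ 0 := by simp [ae_iff]
    filter_upwards [h0] with x hx0 hx
    by_contra hcon
    exact hx (gammaPDF_of_neg (lt_of_le_of_ne (not_lt.1 hcon) hx0))
  integral_rpow s hs := by
    have hmeas : Measurable (gammaPDF a 1) := (measurable_gammaPDFReal a 1).ennreal_ofReal
    rw [gammaMeasure, integral_withDensity_eq_integral_toReal_smul hmeas
      (ae_of_all _ fun x => ENNReal.ofReal_lt_top)]
    have hG := (Real.Gamma_pos_of_pos ha).ne'
    have : ∫ x, (gammaPDF a 1 x).toReal • id x ^ s =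
        ∫ x in Set.Ici (0 : ℝ), (gammaPDF a 1 x).toReal • id x ^ s := by
      refine (setIntegral_eq_integral_of_forall_compl_eq_zero fun x hx => ?_).symm
      rw [gammaPDF_of_neg (not_le.1 hx)]
      simp
    rw [this, integral_Ici_eq_integral_Ioi, gammaRatio, ← integral_Ioi_rpow_mul_exp_neg
      (by positivity : 0 < a + s), div_eq_inv_mul, ← integral_const_mul]
    refine setIntegral_congr_fun measurableSet_Ioi fun x hx => ?_
    have hx' : 0 < x := hx
    simp only [gammaPDF, ENNReal.toReal_ofReal (gammaPDFReal_nonneg ha one_pos x)]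
    rw [gammaPDFReal, if_pos hx'.le, show a + s - 1 = (a - 1) + s by ring, Real.rpow_add hx']
    simp only [Real.one_rpow, one_mul, smul_eq_mul, id]
    ring

theorem hasPowerMoments_expMeasure :
    HasPowerMoments id (expMeasure 1) (fun s => Real.Gamma (1 + s)) := by
  have := (hasPowerMoments_gammaMeasure one_pos).congr_moments fun s _ => gammaRatio_one s
  exact this

/-! ### Negative moments of the stable law -/

/-- The negative moments of a positive random variable in terms of its Laplace transform. -/
theorem lintegral_rpow_mul_lintegral_exp {Ω : Type*} [MeasurableSpace Ω] {P : Measure Ω}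
    [IsProbabilityMeasure P] {Z : Ω → ℝ} (hZ : AEMeasurable Z P) (hpos : ∀ᵐ ω ∂P, 0 < Z ω)
    {t : ℝ} (ht : 0 < t) :
    ∫⁻ l in Set.Ioi (0 : ℝ), ENNReal.ofReal (l ^ (t - 1)) *
        ∫⁻ ω, ENNReal.ofReal (Real.exp (-(l * Z ω))) ∂P =
      ∫⁻ ω, ENNReal.ofReal (Real.Gamma t * Z ω ^ (-t)) ∂P := by
  have : IsProbabilityMeasure (P.map Z) := Measure.isProbabilityMeasure_map hZ
  have hint (z : ℝ) (hz : 0 < z) :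
      ∫⁻ l in Set.Ioi (0 : ℝ), ENNReal.ofReal (l ^ (t - 1) * Real.exp (-(l * z))) =
        ENNReal.ofReal (Real.Gamma t * z ^ (-t)) := by
    have h := Real.integral_rpow_mul_exp_neg_mul_Ioi ht hz
    have hval : Real.Gamma t * z ^ (-t) = (1 / z) ^ t * Real.Gamma t := by
      rw [one_div, Real.inv_rpow hz.le, Real.rpow_neg hz.le, mul_comm]
    have hval_pos : 0 < (1 / z) ^ t * Real.Gamma t :=
      mul_pos (by positivity) (Real.Gamma_pos_of_pos ht)
    simp_rw [mul_comm _ z]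
    rw [hval, ← h, ofReal_integral_eq_lintegral_ofReal]
    · exact Integrable.of_integral_ne_zero (by rw [h]; exact hval_pos.ne')
    · refine ae_restrict_of_forall_mem measurableSet_Ioi fun l hl => ?_
      have : 0 < l := hl
      simp only [Pi.zero_apply]
      positivity
  have hmap (l : ℝ) : ∫⁻ ω, ENNReal.ofReal (Real.exp (-(l * Z ω))) ∂P =
      ∫⁻ z, ENNReal.ofReal (Real.exp (-(l * z))) ∂(P.map Z) := by
    rw [lintegral_map' (by fun_prop) hZ]
  simp_rw [hmap]
  have hswap : ∫⁻ l in Set.Ioi (0 : ℝ), ENNReal.ofReal (l ^ (t - 1)) *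
        ∫⁻ z, ENNReal.ofReal (Real.exp (-(l * z))) ∂(P.map Z) =
      ∫⁻ l in Set.Ioi (0 : ℝ), ∫⁻ z, ENNReal.ofReal (l ^ (t - 1) * Real.exp (-(l * z)))
        ∂(P.map Z) := by
    refine setLIntegral_congr_fun measurableSet_Ioi fun l hl => ?_
    have hl' : 0 < l := hl
    rw [← lintegral_const_mul _ (by fun_prop)]
    refine lintegral_congr fun z => ?_
    rw [ENNReal.ofReal_mul (by positivity)]
  -- Tonelli for nonnegative integrands: finiteness of `E[Z ^ (-t)]` is not needed beforehand.
  rw [hswap, lintegral_lintegral_swap (by fun_prop), lintegral_map' ?_ hZ]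
  · refine lintegral_congr_ae ?_
    filter_upwards [hpos] with ω hω using hint _ hω
  · refine (Measurable.lintegral_prod_right' (f := fun x : ℝ × ℝ =>
      ENNReal.ofReal (x.2 ^ (t - 1) * Real.exp (-(x.2 * x.1)))) (by fun_prop)).aemeasurable

/-- Both sides of `Γ(t) E[Z ^ (-t)] = Γ(t/α) / α` compute the integral of `l ^ (t-1) exp (-l ^ α)`
over `(0, ∞)`; multiplying by `t` gives the stated form. -/
theorem IsPositiveStable.integral_rpow_neg {Ω : Type*} [MeasurableSpace Ω] {P : Measure Ω}
    [IsProbabilityMeasure P] {α : ℝ} (hα : 0 < α) {Z : Ω → ℝ} (hZ : IsPositiveStable α Z P)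
    {t : ℝ} (ht : 0 < t) :
    ∫ ω, Z ω ^ (-t) ∂P = Real.Gamma (1 + t / α) / Real.Gamma (1 + t) := by
  have hΓ := Real.Gamma_pos_of_pos ht
  have h := lintegral_rpow_mul_lintegral_exp hZ.aemeasurable hZ.pos ht
  have hlap (l : ℝ) (hl : 0 < l) : ∫⁻ ω, ENNReal.ofReal (Real.exp (-(l * Z ω))) ∂P =
      ENNReal.ofReal (Real.exp (-l ^ α)) := by
    rw [← hZ.laplace l hl.le, ofReal_integral_eq_lintegral_ofReal]
    · refine Integrable.of_integral_ne_zero ?_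
      rw [hZ.laplace l hl.le]
      positivity
    · exact ae_of_all _ fun ω => (Real.exp_pos _).le
  have hl : ∫⁻ l in Set.Ioi (0 : ℝ), ENNReal.ofReal (l ^ (t - 1)) *
        ∫⁻ ω, ENNReal.ofReal (Real.exp (-(l * Z ω))) ∂P =
      ∫⁻ l in Set.Ioi (0 : ℝ), ENNReal.ofReal (l ^ (t - 1) * Real.exp (-l ^ α)) := by
    refine setLIntegral_congr_fun measurableSet_Ioi fun l hl => ?_
    have hl' : 0 < l := hl
    rw [hlap l hl', ENNReal.ofReal_mul (by positivity)]
  have hI := integral_rpow_mul_exp_neg_rpow hα (by linarith : -1 < t - 1)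
  rw [sub_add_cancel] at hI
  have h2 : ∫ ω, Real.Gamma t * Z ω ^ (-t) ∂P = 1 / α * Real.Gamma (t / α) := by
    rw [integral_eq_lintegral_of_nonneg_ae, ← h, hl, ← hI, integral_eq_lintegral_of_nonneg_ae]
    · refine ae_restrict_of_forall_mem measurableSet_Ioi fun l hl => ?_
      have : 0 < l := hl
      simp only [Pi.zero_apply]
      positivity
    · exact (by fun_prop : Measurable _).aestronglyMeasurable
    · filter_upwards [hZ.pos] with ω hω
      simp only [Pi.zero_apply]
      positivity
    · exact ((hZ.aemeasurable.pow_const (-t)).const_mul _).aestronglyMeasurable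
  rw [integral_const_mul] at h2
  rw [add_comm 1 (t / α), add_comm 1 t, Real.Gamma_add_one (by positivity),
    Real.Gamma_add_one ht.ne', eq_div_iff (by positivity)]
  linear_combination t * h2

theorem IsPositiveStable.hasPowerMoments_zpow_neg {Ω : Type*} [MeasurableSpace Ω] {P : Measure Ω}
    [IsProbabilityMeasure P] {n p : ℕ} (hp : 0 < p) (hn : 0 < n) {Z : Ω → ℝ}
    (hZ : IsPositiveStable ((p : ℝ) / n) Z P) :
    HasPowerMoments (fun ω => Z ω ^ (-(p : ℤ))) P
      (fun s => Real.Gamma (1 + n * s) / Real.Gamma (1 + p * s)) where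
  aemeasurable := (by fun_prop : Measurable fun x : ℝ => x ^ (-(p : ℤ))).comp_aemeasurable
    hZ.aemeasurable
  pos := by filter_upwards [hZ.pos] with ω hω using zpow_pos hω _
  integral_rpow s hs := by
    have hp' : (0 : ℝ) < p := by exact_mod_cast hp
    have hn' : (0 : ℝ) < n := by exact_mod_cast hn
    have h := hZ.integral_rpow_neg (by positivity) (by positivity : 0 < (p : ℝ) * s)
    rw [show (p : ℝ) * s / (p / n) = n * s by field_simp] at h
    rw [← h]
    refine integral_congr_ae ?_
    filter_upwards [hZ.pos] with ω hω
    rw [← Real.rpow_intCast, ← Real.rpow_mul hω.le]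
    push_cast
    ring_nf

/-! ### Matching the moments and the two factorizations -/

noncomputable instance instFintypeBlockPairs (n p : ℕ) : Fintype (BlockPairs n p) :=
  Fintype.subtype (((range p).sigma (qBlock n p)).map
    (Equiv.sigmaEquivProd ℕ ℕ).toEmbedding) fun x => by
      simp only [mem_map, mem_sigma, Equiv.coe_toEmbedding]
      constructor
      · rintro ⟨y, hy, rfl⟩
        exact hy
      · intro h
        exact ⟨⟨x.1, x.2⟩, h, rfl⟩

theorem prod_blockPairs (n p : ℕ) (f : ℕ → ℕ → ℝ) :
    ∏ x : BlockPairs n p, f x.1.1 x.1.2 = ∏ j ∈ range p, ∏ i ∈ qBlock n p j, f j i := by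
  rw [Finset.prod_sigma']
  refine Finset.prod_bij (fun x _ => ⟨x.1.1, x.1.2⟩) (fun x _ => mem_sigma.2 x.2) ?_ ?_
    fun _ _ => rfl
  · intro x _ y _ h
    simp only [Sigma.mk.injEq, heq_eq_eq] at h
    exact Subtype.ext (Prod.ext h.1 h.2)
  · intro y hy
    exact ⟨⟨(y.1, y.2), mem_sigma.1 hy⟩, mem_univ _, rfl⟩

theorem prod_Ico_subtype (p : ℕ) (f : ℕ → ℝ) :
    ∏ j : Finset.Ico 1 p, f j = ∏ j ∈ Finset.Ico 1 p, f j :=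
  Finset.prod_coe_sort _ f

theorem Gamma_div_Gamma_eq_prod_blocks {n p : ℕ} (hp : 1 ≤ p) (hpn : p < n) {s : ℝ}
    (hs : 0 < s) :
    Real.Gamma (1 + n * s) / Real.Gamma (1 + p * s) = ((n : ℝ) ^ n / (p : ℝ) ^ p) ^ s *
      ((∏ j ∈ range p, ∏ i ∈ qBlock n p j, gammaRatio ((i : ℝ) / n) s) *
        ∏ j ∈ Finset.Ico 1 p,
          gammaRatio ((qIndex n p j : ℝ) / n) s / gammaRatio ((j : ℝ) / p) s) := by
  have hIco : Ioo 0 p = Finset.Ico 1 p := by ext; simp; omega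
  have hpos : 0 < ∏ j ∈ Finset.Ico 1 p, gammaRatio ((j : ℝ) / p) s :=
    prod_pos fun j hj => by
      have hj1 : (0 : ℝ) < j := by exact_mod_cast (mem_Ico.1 hj).1
      have hp1 : (0 : ℝ) < p := by exact_mod_cast hp
      exact gammaRatio_pos (by positivity) hs.le
  have hG := Real.Gamma_pos_of_pos (by positivity : 0 < 1 + s)
  have hp' : (0 : ℝ) < p := by exact_mod_cast hp
  rw [prod_Ioo_gammaRatio n (by omega) hs, prod_Ioo_gammaRatio p hp hs,
    prod_Ioo_eq_prod_qBlock hp hpn fun i => gammaRatio ((i : ℝ) / n) s, hIco, prod_div_distrib,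
    Real.div_rpow (by positivity) (by positivity)]
  have hpp : 0 < ((p : ℝ) ^ p) ^ s := by positivity
  field_simp

/-- This exchanges the Gamma factors for `L ^ (n-p)` and Beta factors. Under `k = i - j` the
denominators run over `gammaRatio (k/(n-p)) s` with `0 < k ≤ n-p`, which Gauss' formula cancels
against `Γ(1 + (n-p) s)`. -/
theorem Gamma_mul_prod_blocks {n p : ℕ} (hp : 1 ≤ p) (hpn : p < n) {s : ℝ} (hs : 0 < s) :
    Real.Gamma (1 + ((n - p : ℕ) : ℝ) * s) *
      ∏ j ∈ range p, ∏ i ∈ qBlock n p j,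
        gammaRatio ((i : ℝ) / n) s / gammaRatio (((i : ℝ) - j) / ((n : ℝ) - p)) s =
      (((n : ℝ) - p) ^ (n - p)) ^ s *
        ∏ j ∈ range p, ∏ i ∈ qBlock n p j, gammaRatio ((i : ℝ) / n) s := by
  have hcast : ((n - p : ℕ) : ℝ) = (n : ℝ) - p := Nat.cast_sub hpn.le
  have hnp : (0 : ℝ) < ((n - p : ℕ) : ℝ) := by exact_mod_cast Nat.sub_pos_of_lt hpn
  have hre : ∏ j ∈ range p, ∏ i ∈ qBlock n p j, gammaRatio (((i : ℝ) - j) / ((n : ℝ) - p)) s =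
      ∏ k ∈ Ioc 0 (n - p), gammaRatio ((k : ℝ) / ((n - p : ℕ) : ℝ)) s := by
    rw [← prod_qBlock_sub hp hpn fun k => gammaRatio ((k : ℝ) / ((n - p : ℕ) : ℝ)) s]
    refine prod_congr rfl fun j hj => prod_congr rfl fun i hi => ?_
    rw [hcast, Nat.cast_sub (mem_qBlock_bounds hpn hj hi).2.1.le]
  have hpos : 0 < ∏ k ∈ Ioc 0 (n - p), gammaRatio ((k : ℝ) / ((n - p : ℕ) : ℝ)) s :=
    prod_pos fun k hk => by
      have : (0 : ℝ) < k := by exact_mod_cast (mem_Ioc.1 hk).1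
      exact gammaRatio_pos (by positivity) hs.le
  simp only [prod_div_distrib]
  rw [hre, prod_Ioc_gammaRatio (n - p) (Nat.sub_pos_of_lt hpn) hs, hcast] at *
  field_simp

theorem hasPowerMoments_beta_qIndex {n p j : ℕ} (hpn : p < n) (hj : j ∈ Finset.Ico 1 p)
    {Ω : Type*} [MeasurableSpace Ω] {Q : Measure Ω} {B : Ω → ℝ}
    (hB : HasLaw B (betaMeasure ((qIndex n p j : ℝ) / n)
      ((j : ℝ) / p - (qIndex n p j : ℝ) / n)) Q) :
    HasPowerMoments B Q
      (fun s => gammaRatio ((qIndex n p j : ℝ) / n) s / gammaRatio ((j : ℝ) / p) s) := by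
  obtain ⟨h1, h2⟩ := (qIndex_isGreatest hpn hj).1
  have hp : (0 : ℝ) < p := by
    exact_mod_cast Nat.zero_lt_one.trans ((mem_Ico.1 hj).1.trans_lt (mem_Ico.1 hj).2)
  have hn : (0 : ℝ) < n := hp.trans (by exact_mod_cast hpn)
  have hq : (0 : ℝ) < qIndex n p j := by exact_mod_cast h1
  have hlt : (qIndex n p j : ℝ) * p < j * n := by exact_mod_cast h2
  have hb : 0 < (j : ℝ) / p - (qIndex n p j : ℝ) / n :=
    sub_pos.2 ((div_lt_div_iff₀ hn hp).2 hlt)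
  have := (hasPowerMoments_betaMeasure (by positivity) hb).of_hasLaw hB
  simpa only [add_sub_cancel] using this

theorem hasPowerMoments_beta_qBlock {n p i j : ℕ} (hpn : p < n) (hj : j ∈ range p)
    (hi : i ∈ qBlock n p j) {Ω : Type*} [MeasurableSpace Ω] {Q : Measure Ω} {C : Ω → ℝ}
    (hC : HasLaw C (betaLaw ((i : ℝ) / n)
      (((i : ℝ) - j) / ((n : ℝ) - p) - (i : ℝ) / n)) Q) :
    HasPowerMoments C Q (fun s =>
      gammaRatio ((i : ℝ) / n) s / gammaRatio (((i : ℝ) - j) / ((n : ℝ) - p)) s) := by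
  obtain ⟨h1, -, h2⟩ := mem_qBlock_bounds hpn hj hi
  have hpn' : (p : ℝ) < n := by exact_mod_cast hpn
  have hn : (0 : ℝ) < n := (Nat.cast_nonneg p).trans_lt hpn'
  have hi0 : (0 : ℝ) < i := by exact_mod_cast h1
  have hle : (j : ℝ) * n ≤ i * p := by exact_mod_cast h2
  have hb : 0 ≤ ((i : ℝ) - j) / ((n : ℝ) - p) - (i : ℝ) / n :=
    sub_nonneg.2 ((div_le_div_iff₀ hn (sub_pos.2 hpn')).2 (by linarith))
  have := (hasPowerMoments_betaLaw (by positivity) hb).of_hasLaw hC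
  simpa only [add_sub_cancel] using this

theorem theorem1 (n p : ℕ) (hp : 1 ≤ p) (hpn : p < n)
    {Ω : Type*} [MeasurableSpace Ω] (P : Measure Ω) [IsProbabilityMeasure P]
    (Z : Ω → ℝ) (hZ : IsPositiveStable ((p : ℝ) / n) Z P)
    {Ω' : Type*} [MeasurableSpace Ω'] (Q : Measure Ω') [IsProbabilityMeasure Q] :
    (∀ (G : ℕ → ℕ → Ω' → ℝ) (B : ℕ → Ω' → ℝ),
      (∀ j ∈ Finset.range p, ∀ i ∈ qBlock n p j,
        HasLaw (G j i) (gammaMeasure ((i : ℝ) / n) 1) Q) →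
      (∀ j ∈ Finset.Ico 1 p,
        HasLaw (B j) (betaMeasure ((qIndex n p j : ℝ) / n)
          ((j : ℝ) / p - (qIndex n p j : ℝ) / n)) Q) →
      iIndepFun (Sum.elim (fun x : BlockPairs n p => G x.1.1 x.1.2)
        (fun j : Finset.Ico 1 p => B j)) Q →
      IdentDistrib (fun ω => Z ω ^ (-(p : ℤ)))
        (fun ω' => (n : ℝ) ^ n / (p : ℝ) ^ p *
          (∏ j ∈ Finset.range p, ∏ i ∈ qBlock n p j, G j i ω') *
          ∏ j ∈ Finset.Ico 1 p, B j ω') P Q) ∧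
    (∀ (L : Ω' → ℝ) (C : ℕ → ℕ → Ω' → ℝ) (B : ℕ → Ω' → ℝ),
      HasLaw L (expMeasure 1) Q →
      (∀ j ∈ Finset.range p, ∀ i ∈ qBlock n p j,
        HasLaw (C j i) (betaLaw ((i : ℝ) / n)
          (((i : ℝ) - j) / ((n : ℝ) - p) - (i : ℝ) / n)) Q) →
      (∀ j ∈ Finset.Ico 1 p,
        HasLaw (B j) (betaMeasure ((qIndex n p j : ℝ) / n)
          ((j : ℝ) / p - (qIndex n p j : ℝ) / n)) Q) →
      iIndepFun (Sum.elim (fun _ : Unit => L)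
        (Sum.elim (fun x : BlockPairs n p => C x.1.1 x.1.2)
          (fun j : Finset.Ico 1 p => B j))) Q →
      IdentDistrib (fun ω => Z ω ^ (-(p : ℤ)))
        (fun ω' => (n : ℝ) ^ n / ((p : ℝ) ^ p * ((n : ℝ) - p) ^ (n - p)) *
          L ω' ^ (n - p) *
          (∏ j ∈ Finset.range p, ∏ i ∈ qBlock n p j, C j i ω') *
          ∏ j ∈ Finset.Ico 1 p, B j ω') P Q) := by
  have hn : 0 < n := by omega
  have hp' : (0 : ℝ) < p := by exact_mod_cast hp
  have hn' : (0 : ℝ) < n := by exact_mod_cast hn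
  have hnp' : (0 : ℝ) < (n : ℝ) - p := sub_pos.2 (by exact_mod_cast hpn)
  have hZm := hZ.hasPowerMoments_zpow_neg hp hn
  have hne (s : ℝ) (hs : 0 < s) : Real.Gamma (1 + n * s) / Real.Gamma (1 + p * s) ≠ 0 :=
    (div_pos (Real.Gamma_pos_of_pos (by positivity))
      (Real.Gamma_pos_of_pos (by positivity))).ne'
  constructor
  · intro G B hG hB hind
    refine hZm.identDistrib ?_ hne
    have hmom := HasPowerMoments.prod (M := Sum.elim
        (fun x : BlockPairs n p => gammaRatio ((x.1.2 : ℝ) / n))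
        (fun (j : Finset.Ico 1 p) s =>
          gammaRatio ((qIndex n p j : ℝ) / n) s / gammaRatio ((j : ℝ) / p) s)) ?_ hind
    · have hc := hmom.const_mul (by positivity : 0 < (n : ℝ) ^ n / (p : ℝ) ^ p)
      simp only [Fintype.prod_sum_type, Sum.elim_inl, Sum.elim_inr] at hc
      convert hc.congr_moments (fun s hs => ?_) using 2
      · rename_i ω
        rw [prod_blockPairs n p fun j i => G j i ω, prod_Ico_subtype p fun j => B j ω, mul_assoc]
      · rw [prod_blockPairs n p fun _ i => gammaRatio ((i : ℝ) / n) s,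
          prod_Ico_subtype p fun j => gammaRatio ((qIndex n p j : ℝ) / n) s /
            gammaRatio ((j : ℝ) / p) s, Gamma_div_Gamma_eq_prod_blocks hp hpn hs]
    · rintro (x | j)
      · have hi : (0 : ℝ) < x.1.2 := by
          exact_mod_cast (mem_qBlock_bounds hpn x.2.1 x.2.2).1
        exact (hasPowerMoments_gammaMeasure (by positivity)).of_hasLaw (hG _ x.2.1 _ x.2.2)
      · exact hasPowerMoments_beta_qIndex hpn j.2 (hB j j.2)
  · intro L C B hL hC hB hind
    refine hZm.identDistrib ?_ hne
    -- The power is taken inside the independent family, so that `L ^ (n-p)` counts as one factor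
    -- with moment `Γ(1 + (n-p) s)`.
    have hind' : iIndepFun (Sum.elim (fun (_ : Unit) ω => L ω ^ (n - p))
        (Sum.elim (fun x : BlockPairs n p => C x.1.1 x.1.2)
          (fun j : Finset.Ico 1 p => B j))) Q := by
      have := hind.comp (Sum.elim (fun _ x => x ^ (n - p)) fun _ => id) (by
        rintro (_ | _)
        · exact measurable_id.pow_const _
        · exact measurable_id)
      convert this using 1
      ext (_ | _ | _) <;> rfl
    have hmom := HasPowerMoments.prod (M := Sum.elim
        (fun (_ : Unit) s => Real.Gamma (1 + ((n - p : ℕ) : ℝ) * s)) (Sum.elim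
        (fun (x : BlockPairs n p) s => gammaRatio ((x.1.2 : ℝ) / n) s /
          gammaRatio (((x.1.2 : ℝ) - x.1.1) / ((n : ℝ) - p)) s)
        (fun (j : Finset.Ico 1 p) s =>
          gammaRatio ((qIndex n p j : ℝ) / n) s / gammaRatio ((j : ℝ) / p) s))) ?_ hind'
    · have hc := hmom.const_mul
        (by positivity : 0 < (n : ℝ) ^ n / ((p : ℝ) ^ p * ((n : ℝ) - p) ^ (n - p)))
      simp only [Fintype.prod_sum_type, Sum.elim_inl, Sum.elim_inr, univ_unique,
        prod_singleton] at hc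
      convert hc.congr_moments (fun s hs => ?_) using 2
      · rename_i ω
        rw [prod_blockPairs n p fun j i => C j i ω, prod_Ico_subtype p fun j => B j ω]
        ring
      · rw [prod_blockPairs n p fun j i => gammaRatio ((i : ℝ) / n) s /
            gammaRatio (((i : ℝ) - j) / ((n : ℝ) - p)) s,
          prod_Ico_subtype p fun j => gammaRatio ((qIndex n p j : ℝ) / n) s /
            gammaRatio ((j : ℝ) / p) s, Gamma_div_Gamma_eq_prod_blocks hp hpn hs, ← mul_assoc
            (Real.Gamma _), Gamma_mul_prod_blocks hp hpn hs, ← div_div,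
          Real.div_rpow (by positivity) (by positivity)]
        have : 0 < (((n : ℝ) - p) ^ (n - p)) ^ s := by positivity
        field_simp
    · rintro (_ | x | j)
      · exact (hasPowerMoments_expMeasure.of_hasLaw hL).pow (Nat.sub_pos_of_lt hpn)
      · exact hasPowerMoments_beta_qBlock hpn x.2.1 x.2.2 (hC _ x.2.1 _ x.2.2)
      · exact hasPowerMoments_beta_qIndex hpn j.2 (hB j j.2)
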